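/- **Definitions.** Let $\mathbf{x}=(x_1,\dots,x_m)$ be parameters. A parametric Markov chain (pMC) $\mathcal M=(S,P)$ with $S=\{1,\dots,n\}$ consists of polynomials $p_{ij}=P(i,j)\in\mathbb{Q}[\mathbf{x}]$, $1\le i,j\le n$. A valuation $v\in\mathbb{R}^m$ is *graph preserving* if $0<p_{ij}(v)\le 1$ whenever $p_{ij}\not\equiv 0$, and $\sum_k p_{ik}(v)=1$ for all $i$. For $f\in\mathbb{Q}[\mathbf{x}]$ let $\mathrm{coeff}(f)$ be the largest absolute value of a numerator or denominator of its nonzero coefficients in lowest terms. The size of the pMC is $$|\mathcal M|=\sum_{i,j}|\mathrm{supp}(p_{ij})|\cdot\max(1,\deg p_{ij})\cdot\max(1,\log_2\mathrm{coeff}(p_{ij})).$$ We assume that $n\ge 2$, that $\mathcal M$ has at least one graph-preserving valuation, and that in the graph with edges $\{(i,j): p_{ij}\not\equiv 0\}$ the state $n-1$ is the unique state from which the target state $n$ cannot be reached. The *value functions* $g_1,\dots,g_n\in\mathbb{Q}(\mathbf{x})$ are the solution of $(\mathbb{I}_n-A)\,\mathbf{g}=(0,\dots,0,1)^{\mathsf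 T}$, where $A_{ij}=p_{ij}$ for $i<n-1$ and $A_{ij}=0$ for $i\in\{n-1,n\}$. An *algebraic branching program* (ABP) over $\mathbb{Q}[\mathbf{x}]$ is a directed acyclic graph whose vertex set $V$ is partitioned into layers $V_0,\dots,V_L$ such that each edge goes from some $V_i$ to $V_{i+1}$, $V_0$ and $V_L$ have a single vertex (the source and the sink), every vertex lies on a path from the source to the sink, and every edge $e$ has a label $\ell(e)\in\mathbb{Q}[\mathbf{x}]$ of degree at most $1$. Its size is $|V|$, its width is $\max_i|V_i|$, and it computes the polynomial $[\![\mathcal A]\!]=\sum_{\pi}\prod_{e\in\pi}\ell(e)$, the sum being over all maximal paths $\pi$. **Theorem.** There is an absolute constant $C$ such that for every pMC $\mathcal M$ as above, with $d=\max_{i,j}\deg p_{ij}$ and value functions $g_1,\dots,g_n$, there are ABPs $\mathcal N_{i,j}$ and $\mathcal D_i$ over $\mathbb{Q}[\mathbf{x}]$ ($1\le i\le n$, $1\le j\le m$), each of width $4$ and of size at most $$|\mathcal M|^{\,C\log_2(n\cdot\max(1,d))},$$ (that is, of size $|\mathcal M|^{O(\log(nd))}$), such that $[\![\mathcal D_i]\!]\neq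 0$ and $$\frac{[\![\mathcal N_{i,j}]\!]}{[\![\mathcal D_i]\!]}=\frac{\partial g_i}{\partial x_j}\quad\text{in }\mathbb{Q}(\mathbf{x}),\qquad\text{for all }1\le i\le n,\ 1\le j\le m.$$ -/

import Mathlib

noncomputable section

/-- The field `ℚ(x₁, …, x_m)` of rational functions in `m` parameters. -/
abbrev RationalFunction (m : ℕ) : Type := FractionRing (MvPolynomial (Fin m) ℚ)

/-- The formal partial derivative `∂/∂x_j` on `ℚ(x₁, …, x_m)`, by the quotient rule applied to
the reduced fraction. By `RationalFunction.pderiv_div` any other fraction gives the same value. -/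
def RationalFunction.pderiv {m : ℕ} (j : Fin m) (g : RationalFunction m) : RationalFunction m :=
  let a : MvPolynomial (Fin m) ℚ := IsFractionRing.num (MvPolynomial (Fin m) ℚ) g
  let b : MvPolynomial (Fin m) ℚ := (IsFractionRing.den (MvPolynomial (Fin m) ℚ) g).1
  algebraMap _ (RationalFunction m) (MvPolynomial.pderiv j a * b - a * MvPolynomial.pderiv j b) /
    algebraMap _ (RationalFunction m) (b ^ 2)

/-- The quotient rule, for an arbitrary representation of a rational function as a fraction. -/
theorem RationalFunction.pderiv_div {m : ℕ} (j : Fin m) (a b : MvPolynomial (Fin m) ℚ)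
    (hb : b ≠ 0) :
    RationalFunction.pderiv j (algebraMap _ (RationalFunction m) a / algebraMap _ _ b) =
      algebraMap _ (RationalFunction m)
        (MvPolynomial.pderiv j a * b - a * MvPolynomial.pderiv j b) /
      algebraMap _ (RationalFunction m) (b ^ 2) := by
  set g : RationalFunction m := algebraMap _ (RationalFunction m) a / algebraMap _ _ b with hg
  have hinj := IsFractionRing.injective (MvPolynomial (Fin m) ℚ) (RationalFunction m)
  simp only [RationalFunction.pderiv]
  set c : MvPolynomial (Fin m) ℚ := IsFractionRing.num (MvPolynomial (Fin m) ℚ) g with hc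
  set e : MvPolynomial (Fin m) ℚ := (IsFractionRing.den (MvPolynomial (Fin m) ℚ) g).1 with he
  have he0 : e ≠ 0 := nonZeroDivisors.ne_zero (IsFractionRing.den _ g).2
  have h1 : algebraMap _ (RationalFunction m) c / algebraMap _ _ e = g :=
    IsFractionRing.mk'_num_den' _ g
  have hb' : algebraMap _ (RationalFunction m) b ≠ 0 := by
    simpa using hb
  have he' : algebraMap _ (RationalFunction m) e ≠ 0 := by
    simpa using he0
  have h2 : c * b = a * e := by
    apply hinj
    rw [map_mul, map_mul]
    rw [hg, div_eq_div_iff he' hb'] at h1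
    exact h1
  have h3 := congrArg (MvPolynomial.pderiv j) h2
  simp only [Derivation.leibniz, smul_eq_mul] at h3
  rw [div_eq_div_iff (by simpa using he0) (by simpa using hb), ← map_mul, ← map_mul]
  congr 1
  linear_combination (b * e) * h3 -
    (b * MvPolynomial.pderiv j e + e * MvPolynomial.pderiv j b) * h2

/-- The largest absolute value of a numerator or denominator among the nonzero coefficients of `f`,
written as irreducible fractions (and `0` for `f = 0`). -/
def maxCoeffComponent {m : ℕ} (f : MvPolynomial (Fin m) ℚ) : ℕ :=
  f.support.sup fun α => max (f.coeff α).num.natAbs (f.coeff α).den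

/-- The representation size of a polynomial: number of monomials, times degree (exponents are in
unary), times number of bits of the coefficients. A degree or a bit length below `1` is
counted as `1`, so that every monomial contributes. -/
def polySize {m : ℕ} (f : MvPolynomial (Fin m) ℚ) : ℝ :=
  (f.support.card : ℝ) * max 1 (f.totalDegree : ℝ) * max 1 (Real.logb 2 (maxCoeffComponent f))

/-- A parametric Markov chain with states `1, …, n` (represented by `Fin n`, so that state `s` is
the element of value `s - 1`) and parameters `x₁, …, x_m`. -/
structure ParametricMC (n m : ℕ) where
  P : Fin n → Fin n → MvPolynomial (Fin m) ℚ

namespace ParametricMC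

variable {n m : ℕ}

/-- `v` is a graph-preserving valuation. -/
def GraphPreserving (M : ParametricMC n m) (v : Fin m → ℝ) : Prop :=
  (∀ i j, M.P i j ≠ 0 →
    0 < MvPolynomial.aeval v (M.P i j) ∧ MvPolynomial.aeval v (M.P i j) ≤ 1) ∧
  ∀ i, ∑ k, MvPolynomial.aeval v (M.P i k) = 1

/-- State `i` reaches state `k` in the underlying graph, whose edges are the transitions that are
not identically zero. -/
def Reaches (M : ParametricMC n m) (i k : Fin n) : Prop :=
  Relation.ReflTransGen (fun s t => M.P s t ≠ 0) i k

/-- State `n` is the target and state `n - 1` is the unique state that does not reach it. -/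
def Normalized (M : ParametricMC n m) : Prop :=
  2 ≤ n ∧ ∀ t : Fin n, t.val + 1 = n → ∀ i : Fin n, ¬ M.Reaches i t ↔ i.val + 2 = n

/-- The size `|M|`. -/
def size (M : ParametricMC n m) : ℝ := ∑ i, ∑ j, polySize (M.P i j)

/-- The maximal degree of a transition polynomial. -/
def degree (M : ParametricMC n m) : ℕ :=
  Finset.univ.sup fun i => Finset.univ.sup fun j => (M.P i j).totalDegree

/-- The matrix `A`: the transition matrix with the rows of the states `n - 1` and `n` set to `0`. -/
def reachMatrix (M : ParametricMC n m) : Matrix (Fin n) (Fin n) (MvPolynomial (Fin m) ℚ) :=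
  Matrix.of fun i j => if i.val + 2 < n then M.P i j else 0

/-- `g` is the vector of reachability value functions: `(I - A) g = (0, …, 0, 1)`. -/
def IsValueFunctions (M : ParametricMC n m) (g : Fin n → RationalFunction m) : Prop :=
  Matrix.mulVec ((1 - M.reachMatrix).map (algebraMap _ (RationalFunction m))) g =
    fun i => if i.val + 1 = n then 1 else 0

end ParametricMC

/-- A single-source, single-sink algebraic branching program over `ℚ[x₁, …, x_m]`, with
layers `0, …, L`: the first and the last layer have a single vertex, the source and the sink,
and no other vertex lacks an incoming or an outgoing edge, so that the maximal paths are exactly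
the paths from the source to the sink. Only the labels of edges matter. -/
structure ABP (m : ℕ) where
  V : Type
  [fintypeV : Fintype V]
  L : ℕ
  layer : V → Fin (L + 1)
  Edge : V → V → Prop
  label : V → V → MvPolynomial (Fin m) ℚ
  edge_layer : ∀ u v, Edge u v → (layer v).val = (layer u).val + 1
  label_degree : ∀ u v, Edge u v → (label u v).totalDegree ≤ 1
  source : ∃! v, layer v = 0
  sink : ∃! v, layer v = Fin.last L
  exists_in : ∀ v, layer v ≠ 0 → ∃ u, Edge u v
  exists_out : ∀ u, layer u ≠ Fin.last L → ∃ v, Edge u v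

namespace ABP

variable {m : ℕ}

instance (A : ABP m) : Fintype A.V := A.fintypeV

/-- The number of vertices. -/
def size (A : ABP m) : ℕ := Fintype.card A.V

/-- The cardinality of the largest layer. -/
def width (A : ABP m) : ℕ :=
  Finset.univ.sup fun i : Fin (A.L + 1) => Nat.card {v : A.V // A.layer v = i}

/-- A path, as the nonempty list of its vertices. -/
def IsPath (A : ABP m) (p : List A.V) : Prop := p ≠ [] ∧ p.IsChain A.Edge

/-- A maximal path: one that cannot be extended at either end. -/
def IsMaximalPath (A : ABP m) (p : List A.V) : Prop :=
  A.IsPath p ∧ (∀ u, ¬ A.IsPath (u :: p)) ∧ ∀ u, ¬ A.IsPath (p ++ [u])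

theorem layer_add_length_le (A : ABP m) :
    ∀ (p : List A.V) (u : A.V), (u :: p).IsChain A.Edge → (A.layer u).val + p.length ≤ A.L
  | [], u, _ => by
    have := (A.layer u).isLt
    simp only [List.length_nil]
    omega
  | v :: q, u, h => by
    rw [List.isChain_cons_cons] at h
    have h1 := layer_add_length_le A q v h.2
    have h2 := A.edge_layer u v h.1
    simp only [List.length_cons]
    omega

theorem finite_maximalPaths (A : ABP m) : {p | A.IsMaximalPath p}.Finite := by
  refine (List.finite_length_le A.V (A.L + 1)).subset ?_
  rintro p ⟨⟨hne, hp⟩, -, -⟩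
  cases p with
  | nil => exact absurd rfl hne
  | cons u q =>
    have := A.layer_add_length_le q u hp
    simp only [Set.mem_ofPred_eq, List.length_cons]
    omega

/-- The product of the labels of the edges of a path. -/
def pathLabel (A : ABP m) (p : List A.V) : MvPolynomial (Fin m) ℚ :=
  (List.zipWith A.label p p.tail).prod

/-- The polynomial computed by `A`: the sum over all maximal paths of the product of the labels. -/
def computes (A : ABP m) : MvPolynomial (Fin m) ℚ :=
  ∑ p ∈ A.finite_maximalPaths.toFinset, A.pathLabel p

end ABP

end

/-!
By Cramer's rule the value functions are `g_i = adj(I - A)_{i,n} / det(I - A)`, and the quotient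
rule writes `∂g_i/∂x_j` as a fraction whose numerator and denominator are built from these two
polynomials and their partial derivatives. So it is enough to find shallow formulas for the entries
of `adj(I - A)` and for `det(I - A)`, and to turn shallow formulas into narrow branching programs.

*The denominator is nonzero.* At a graph-preserving valuation, a vector in the kernel of `I - A` is
harmonic at all states except the last two, where it vanishes. By the maximum principle the set of
states where its absolute value is maximal is closed under transitions, so it contains the target,
and the vector is zero (`ParametricMC.det_one_sub_reachMatrix_ne_zero`).

*Shallow formulas* (Csanky's algorithm). By the Cayley-Hamilton theorem `det(I - A)` and
`adj(I - A)` are polynomial expressions in the coefficients of the characteristic polynomial and the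
powers of `A` (`Matrix.det_one_sub`, `Matrix.adjugate_one_sub`). The powers have depth
`O(log² n)` over the entries, by repeated squaring. The coefficients solve Newton's identities
(`Matrix.newton_charpoly_coeff`), a unitriangular linear system whose entries are rational multiples
of traces of powers of `A`; its inverse is a finite geometric sum of powers of a strictly triangular
matrix, so the depth is `O(log² n)` again (`Matrix.HasFormulas.charpoly_coeff`). The entries of `A`
themselves have depth `O(log |M|)`. Differentiation at most doubles the depth
(`HasFormula.pderiv`).

*Width four* (Ben-Or and Cleve). A formula of depth `k` for `f` gives an expression of the
transvection `1 + f E_{ij}` as a product of at most `4 ^ k` matrices with entries of degree at most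
one: a sum corresponds to a product of transvections, and a product to a commutator
(`HasFormula.exists_list_prod_eq_transvection`). An entry of a product of `4 × 4` matrices is
computed by a branching program of width four (`ABP.computes_ofMatrixProduct`). With
`k = O(log |M| + log² n)` and `n ≤ |M|`, the number of factors is `|M| ^ O(log n)`.
-/

noncomputable section

/-! ### The characteristic polynomial, the adjugate and Newton's identities -/

open Polynomial Matrix in
theorem Matrix.derivative_det {ι R : Type*} [Fintype ι] [DecidableEq ι] [CommRing R]
    (M : Matrix ι ι R[X]) :
    derivative M.det = ∑ i, (M.updateCol i fun k => derivative (M k i)).det := by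
  simp only [det_apply, derivative_sum, Units.smul_def, zsmul_eq_mul]
  rw [Finset.sum_comm]
  refine Finset.sum_congr rfl fun σ _ => ?_
  rw [← Finset.mul_sum, derivative_mul, derivative_intCast, zero_mul, zero_add,
    derivative_prod_finset]
  congr 1
  refine Finset.sum_congr rfl fun i _ => ?_
  rw [← Finset.prod_erase_mul _ _ (Finset.mem_univ i)]
  congr 1
  · refine Finset.prod_congr rfl fun j hj => ?_
    rw [updateCol_ne (Finset.ne_of_mem_erase hj)]
  · rw [updateCol_self]

open Polynomial Matrix in
/-- Jacobi's formula for `det (X - A)`. -/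
theorem Matrix.derivative_charpoly {ι R : Type*} [Fintype ι] [DecidableEq ι] [CommRing R]
    (A : Matrix ι ι R) : derivative A.charpoly = (adjugate (charmatrix A)).trace := by
  rw [Matrix.charpoly, derivative_det, Matrix.trace]
  refine Finset.sum_congr rfl fun i _ => ?_
  have h : (fun k => derivative (charmatrix A k i)) = Pi.single i 1 := by
    funext k
    rcases eq_or_ne k i with rfl | hk
    · simp
    · simp [hk]
  rw [h, diag_apply, ← transpose_apply (adjugate _), adjugate_transpose, adjugate_apply,
    updateRow_transpose, det_transpose]

open Polynomial Matrix in
/-- The polynomial `(p(X) - p(Y)) / (X - Y)`, for `p` the characteristic polynomial, evaluated at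
`Y = A`: by the Cayley-Hamilton theorem its product with `X - A` is `p(X)`. -/
theorem Matrix.adjugate_charmatrix {ι R : Type*} [Fintype ι] [DecidableEq ι] [CommRing R]
    [IsDomain R] (A : Matrix ι ι R) :
    adjugate (charmatrix A) = ∑ k ∈ Finset.range (Fintype.card ι + 1),
      ∑ l ∈ Finset.range k, (C (A.charpoly.coeff k) * X ^ (k - 1 - l)) • (C.mapMatrix A) ^ l := by
  set Q := ∑ k ∈ Finset.range (Fintype.card ι + 1),
      ∑ l ∈ Finset.range k, (C (A.charpoly.coeff k) * X ^ (k - 1 - l)) • (C.mapMatrix A) ^ l with hQ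
  have hdeg : A.charpoly.natDegree < Fintype.card ι + 1 := by
    rw [charpoly_natDegree_eq_dim]; omega
  have key : charmatrix A * Q = A.charpoly • (1 : Matrix ι ι R[X]) := by
    have hsc : ∀ k : ℕ, scalar ι (X : R[X]) ^ k = (X : R[X]) ^ k • (1 : Matrix ι ι R[X]) := by
      intro k
      rw [← map_pow, smul_one_eq_diagonal, scalar_apply]
    have h1 : ∀ k, charmatrix A * ∑ l ∈ Finset.range k,
        (C (A.charpoly.coeff k) * (X : R[X]) ^ (k - 1 - l)) • (C.mapMatrix A) ^ l =
        C (A.charpoly.coeff k) •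
          ((X : R[X]) ^ k • (1 : Matrix ι ι R[X]) - (C.mapMatrix A) ^ k) := by
      intro k
      have hc : Commute (C.mapMatrix A) (scalar ι (X : R[X])) :=
        (scalar_commute (X : R[X]) (fun _ => Commute.all _ _) _).symm
      have := hc.mul_geom_sum₂ k
      rw [← hsc, ← neg_sub, ← this, smul_neg, ← neg_sub (scalar ι (X : R[X])), neg_mul, smul_neg,
        neg_neg, Finset.mul_sum, Finset.mul_sum, Finset.smul_sum, charmatrix]
      refine Finset.sum_congr rfl fun l _ => ?_
      rw [hsc, mul_smul, mul_smul_comm, mul_smul_comm, mul_smul_comm, mul_one, mul_smul_comm]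
    rw [hQ, Finset.mul_sum, Finset.sum_congr rfl fun k _ => h1 k]
    simp only [smul_sub, Finset.sum_sub_distrib]
    -- the Cayley-Hamilton theorem, with coefficients lifted to `R[X]`
    have hCH : ∑ k ∈ Finset.range (Fintype.card ι + 1),
        C (A.charpoly.coeff k) • (C.mapMatrix A) ^ k = 0 := by
      have h2 := congrArg (C : R →+* R[X]).mapMatrix (aeval_self_charpoly A)
      rw [aeval_eq_sum_range' hdeg, map_sum, map_zero] at h2
      rw [← h2]
      refine Finset.sum_congr rfl fun k _ => ?_
      rw [← map_pow]
      ext i j : 2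
      simp
    rw [hCH, sub_zero]
    simp only [smul_smul, ← Finset.sum_smul]
    rw [← as_sum_range_C_mul_X_pow' _ hdeg]
  have h0 : A.charpoly ≠ 0 := A.charpoly_monic.ne_zero
  -- multiplying `(X - A) Q = p(X)` by the adjugate, `p` can be cancelled
  have h3 : A.charpoly • Q = A.charpoly • adjugate (charmatrix A) := by
    have h4 := congrArg (adjugate (charmatrix A) * ·) key
    simp only [← mul_assoc, adjugate_mul, mul_smul_comm, mul_one, smul_mul_assoc, one_mul] at h4
    exact h4
  exact ((smul_right_injective _ h0) h3).symm

open Polynomial Matrix in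
theorem Matrix.adjugate_one_sub {ι R : Type*} [Fintype ι] [DecidableEq ι] [CommRing R]
    [IsDomain R] (A : Matrix ι ι R) :
    adjugate (1 - A) = ∑ k ∈ Finset.range (Fintype.card ι + 1),
      ∑ l ∈ Finset.range k, A.charpoly.coeff k • A ^ l := by
  have h := congrArg (evalRingHom (1 : R)).mapMatrix (adjugate_charmatrix A)
  have h1 : (evalRingHom (1 : R)).mapMatrix (charmatrix A) = 1 - A := by
    ext i j
    by_cases hij : i = j <;> simp [hij]
  have h2 : (evalRingHom (1 : R)).mapMatrix (C.mapMatrix A) = A := by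
    ext i j
    simp
  rw [RingHom.map_adjugate, h1] at h
  rw [h, map_sum]
  refine Finset.sum_congr rfl fun k _ => ?_
  rw [map_sum]
  refine Finset.sum_congr rfl fun l _ => ?_
  have h3 : A ^ l = (evalRingHom (1 : R)).mapMatrix ((C.mapMatrix A) ^ l) := by
    rw [map_pow, h2]
  rw [h3]
  ext i j
  simp

open Polynomial Matrix in
theorem Matrix.det_one_sub {ι R : Type*} [Fintype ι] [DecidableEq ι] [CommRing R]
    [IsDomain R] (A : Matrix ι ι R) :
    (1 - A).det = ∑ k ∈ Finset.range (Fintype.card ι + 1), A.charpoly.coeff k := by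
  have h := eval_charpoly A 1
  rw [map_one] at h
  rw [← h, eval_eq_sum_range, charpoly_natDegree_eq_dim]
  simp


open Polynomial Matrix in
/-- Newton's identities between the coefficients of the characteristic polynomial and the traces of
the powers of a matrix. They come from comparing coefficients in `p' = tr adj(X - A)`; the case
`i = card ι` is the trace of the Cayley-Hamilton theorem. -/
theorem Matrix.newton_charpoly_coeff {ι R : Type*} [Fintype ι] [DecidableEq ι] [CommRing R]
    [IsDomain R] (A : Matrix ι ι R) {i : ℕ} (hi : i ≤ Fintype.card ι) :
    (i : R) * A.charpoly.coeff (Fintype.card ι - i) +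
      ∑ j ∈ Finset.range i, A.charpoly.coeff (Fintype.card ι - j) * (A ^ (i - j)).trace = 0 := by
  set n := Fintype.card ι with hn
  rcases hi.eq_or_lt with rfl | hi
  · have hdeg : A.charpoly.natDegree < n + 1 := by
      rw [charpoly_natDegree_eq_dim]; omega
    have h := congrArg trace (aeval_self_charpoly A)
    rw [aeval_eq_sum_range' hdeg, trace_sum, ← Finset.sum_range_reflect, trace_zero,
      Finset.sum_range_succ] at h
    simp only [trace_smul, smul_eq_mul, add_tsub_cancel_right, tsub_self, pow_zero, trace_one] at h
    rw [tsub_self, mul_comm, add_comm]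
    exact h
  · have h := congrArg (coeff · (n - i - 1)) (derivative_charpoly A)
    have htr : ∀ l, ((C.mapMatrix A) ^ l).trace = C (A ^ l).trace := by
      intro l
      rw [← map_pow]
      simp [trace]
    simp only [adjugate_charmatrix, trace_sum, trace_smul, htr, coeff_derivative, smul_eq_mul,
      finsetSum_coeff, mul_assoc, coeff_C_mul, coeff_X_pow_mul', coeff_C, mul_ite, mul_zero] at h
    -- for each `k` only `l = k - (n - i)` contributes to the coefficient of `X ^ (n - i - 1)`
    have hk : ∀ k ∈ Finset.range (n + 1), (∑ l ∈ Finset.range k,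
        if k - 1 - l ≤ n - i - 1 then
          if n - i - 1 - (k - 1 - l) = 0 then A.charpoly.coeff k * (A ^ l).trace else 0 else 0) =
        if n - i ≤ k then A.charpoly.coeff k * (A ^ (k - (n - i))).trace else 0 := by
      intro k _
      split_ifs with hle
      · rw [Finset.sum_eq_single_of_mem (k - (n - i)) (Finset.mem_range.2 (by omega)),
          if_pos (by omega), if_pos (by omega)]
        intro l hl hne
        rw [Finset.mem_range] at hl
        split_ifs with h1 h2
        · omega
        · rfl
        · rfl
      · refine Finset.sum_eq_zero fun l hl => ?_
        rw [Finset.mem_range] at hl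
        split_ifs with h1 h2
        · omega
        · rfl
        · rfl
    rw [← hn, Finset.sum_congr rfl hk, ← Finset.sum_range_reflect,
      ← Finset.sum_subset (Finset.range_mono (show i + 1 ≤ n + 1 by omega)),
      Finset.sum_range_succ] at h
    · have h2 : ∀ j ∈ Finset.range i, (if n - i ≤ n + 1 - 1 - j then
          A.charpoly.coeff (n + 1 - 1 - j) * (A ^ (n + 1 - 1 - j - (n - i))).trace else 0) =
          A.charpoly.coeff (n - j) * (A ^ (i - j)).trace := by
        intro j hj
        rw [Finset.mem_range] at hj
        rw [if_pos (by omega)]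
        congr 3
        omega
      rw [Finset.sum_congr rfl h2, if_pos (by omega), show n + 1 - 1 - i - (n - i) = 0 by omega,
        pow_zero, trace_one, show n + 1 - 1 - i = n - i by omega, ← hn,
        show n - i - 1 + 1 = n - i by omega] at h
      have h3 : ((n - i - 1 : ℕ) : R) + 1 = n - i := by
        rw [← Nat.cast_sub hi.le, ← Nat.cast_succ]
        congr 1
        omega
      rw [h3] at h
      linear_combination -h
    · intro j hj hj2
      rw [Finset.mem_range] at hj hj2
      rw [if_neg (by omega)]

open MvPolynomial

/-! ### Arithmetic formulas of small depth -/

/-- `HasFormula k f`: `f` is computed by an arithmetic formula of depth at most `k` whose leaves are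
polynomials of degree at most one. A leaf may stand at any depth, so that the predicate is monotone
in `k`. -/
inductive HasFormula {m : ℕ} : ℕ → MvPolynomial (Fin m) ℚ → Prop
  | leaf {f} (k : ℕ) : f.totalDegree ≤ 1 → HasFormula k f
  | add {k f g} : HasFormula k f → HasFormula k g → HasFormula (k + 1) (f + g)
  | mul {k f g} : HasFormula k f → HasFormula k g → HasFormula (k + 1) (f * g)

theorem MvPolynomial.totalDegree_pderiv_le {σ R : Type*} [CommSemiring R] (i : σ)
    (f : MvPolynomial σ R) : (pderiv i f).totalDegree ≤ f.totalDegree := by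
  classical
  conv_lhs => rw [f.as_sum, map_sum]
  refine totalDegree_finsetSum_le fun α hα => ?_
  rw [pderiv_monomial]
  refine (totalDegree_monomial_le _ _).trans (le_trans ?_ (le_totalDegree hα))
  exact Finsupp.sum_le_sum_index tsub_le_self (fun _ _ => monotone_id) fun _ _ => rfl

namespace HasFormula

variable {m : ℕ}

theorem mono {k l : ℕ} {f : MvPolynomial (Fin m) ℚ} (h : HasFormula k f) (hkl : k ≤ l) :
    HasFormula l f := by
  induction h generalizing l with
  | leaf k hf => exact leaf l hf
  | add _ _ ihf ihg =>
    obtain ⟨l, rfl⟩ : ∃ l', l = l' + 1 := ⟨l - 1, by omega⟩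
    exact add (ihf (by omega)) (ihg (by omega))
  | mul _ _ ihf ihg =>
    obtain ⟨l, rfl⟩ : ∃ l', l = l' + 1 := ⟨l - 1, by omega⟩
    exact mul (ihf (by omega)) (ihg (by omega))

theorem C (k : ℕ) (c : ℚ) : HasFormula k (MvPolynomial.C c : MvPolynomial (Fin m) ℚ) :=
  leaf k (by simp)

theorem zero (k : ℕ) : HasFormula k (0 : MvPolynomial (Fin m) ℚ) := leaf k (by simp)

theorem one (k : ℕ) : HasFormula k (1 : MvPolynomial (Fin m) ℚ) := leaf k (by simp)

theorem neg {k : ℕ} {f : MvPolynomial (Fin m) ℚ} (h : HasFormula k f) : HasFormula k (-f) := by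
  induction h with
  | leaf k hf => exact leaf k (by rwa [totalDegree_neg])
  | add _ _ ihf ihg => rw [neg_add]; exact add ihf ihg
  | mul _ hg ihf _ => rw [← neg_mul]; exact mul ihf hg

theorem sub {k : ℕ} {f g : MvPolynomial (Fin m) ℚ} (hf : HasFormula k f) (hg : HasFormula k g) :
    HasFormula (k + 1) (f - g) := by
  rw [sub_eq_add_neg]
  exact hf.add hg.neg

/-- Differentiation at most doubles the depth: the product rule replaces one multiplication by an
addition of two multiplications. -/
theorem pderiv {k : ℕ} {f : MvPolynomial (Fin m) ℚ} (h : HasFormula k f) (j : Fin m) :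
    HasFormula (2 * k) (MvPolynomial.pderiv j f) := by
  induction h with
  | leaf k hf => exact leaf _ ((totalDegree_pderiv_le _ _).trans hf)
  | add _ _ ihf ihg =>
    rw [map_add]
    exact (ihf.add ihg).mono (by omega)
  | @mul k f g hf hg ihf ihg =>
    rw [Derivation.leibniz, smul_eq_mul, smul_eq_mul]
    exact ((hf.mono (by omega)).mul ihg).add ((hg.mono (by omega)).mul ihf)

/-- A sum of at most `2 ^ e` terms is computed by a balanced tree of additions. -/
theorem sum {ι : Type*} {k e : ℕ} (s : Finset ι) (hs : s.card ≤ 2 ^ e)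
    {f : ι → MvPolynomial (Fin m) ℚ} (hf : ∀ i ∈ s, HasFormula k (f i)) :
    HasFormula (k + e) (∑ i ∈ s, f i) := by
  classical
  induction e generalizing s with
  | zero =>
    rcases s.eq_empty_or_nonempty with rfl | ⟨i, hi⟩
    · exact zero _
    · have h1 : s = {i} := Finset.eq_singleton_iff_unique_mem.2
        ⟨hi, fun j hj => Finset.card_le_one.1 hs j hj i hi⟩
      rw [h1, Finset.sum_singleton]
      exact hf i hi
  | succ e ih =>
    obtain ⟨t, hts, ht⟩ := Finset.exists_subset_card_eq (Nat.div_le_self s.card 2)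
    rw [← Finset.sum_sdiff hts, ← add_assoc]
    refine add (ih _ ?_ fun i hi => hf i (Finset.sdiff_subset hi))
      (ih _ ?_ fun i hi => hf i (hts hi))
    · rw [Finset.card_sdiff_of_subset hts, ht]
      omega
    · omega

/-- A product of at most `2 ^ e` factors is computed by a balanced tree of multiplications. -/
theorem list_prod {k e : ℕ} (l : List (MvPolynomial (Fin m) ℚ)) (hl : l.length ≤ 2 ^ e)
    (hf : ∀ f ∈ l, HasFormula k f) : HasFormula (k + e) l.prod := by
  induction e generalizing l with
  | zero =>
    match l with
    | [] => exact one _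
    | [f] => simpa using hf
    | f :: g :: l => simp at hl
  | succ e ih =>
    rw [← List.prod_take_mul_prod_drop l (2 ^ e), ← add_assoc]
    refine mul (ih _ ?_ fun f hl => hf f (List.mem_of_mem_take hl))
      (ih _ ?_ fun f hl => hf f (List.mem_of_mem_drop hl))
    · rw [List.length_take]
      omega
    · rw [List.length_drop]
      omega

/-- The sum-of-monomials formula; the extra level multiplies each monomial by its coefficient. -/
theorem of_card_le_of_totalDegree_le {d e : ℕ} (f : MvPolynomial (Fin m) ℚ)
    (hd : f.totalDegree ≤ 2 ^ d) (he : f.support.card ≤ 2 ^ e) : HasFormula (d + 1 + e) f := by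
  rw [f.as_sum]
  refine sum _ he fun α hα => ?_
  have h1 : (α.prod fun i r => (X i : MvPolynomial (Fin m) ℚ) ^ r) =
      ((Finsupp.toMultiset α).toList.map X).prod := by
    rw [Multiset.prod_map_toList, Finsupp.toMultiset_map, Finsupp.prod_toMultiset]
    rw [Finsupp.prod_mapDomain_index (by simp) (by simp [pow_add])]
  rw [monomial_eq, h1]
  refine mul (C _ _) (((list_prod (k := 0) (e := d) _ ?_ ?_)).mono (by omega))
  · rw [List.length_map, Multiset.length_toList, Finsupp.card_toMultiset]
    exact (le_totalDegree hα).trans hd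
  · intro f hf
    obtain ⟨i, -, rfl⟩ := List.mem_map.1 hf
    exact leaf _ (by simp)

end HasFormula

/-- All entries of `A` have formulas of depth at most `k`. -/
def Matrix.HasFormulas {m : ℕ} {ι : Type*} (k : ℕ) (A : Matrix ι ι (MvPolynomial (Fin m) ℚ)) :
    Prop :=
  ∀ i j, HasFormula k (A i j)

namespace Matrix.HasFormulas

variable {m : ℕ} {ι : Type*} {e : ℕ}

theorem mono {k l : ℕ} {A : Matrix ι ι (MvPolynomial (Fin m) ℚ)} (hA : A.HasFormulas k)
    (hkl : k ≤ l) : A.HasFormulas l :=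
  fun i j => (hA i j).mono hkl

variable [Fintype ι]

theorem trace {k : ℕ} {A : Matrix ι ι (MvPolynomial (Fin m) ℚ)} (hA : A.HasFormulas k)
    (he : Fintype.card ι ≤ 2 ^ e) : HasFormula (k + e) A.trace :=
  HasFormula.sum _ he fun i _ => hA i i

theorem mul {k : ℕ} {A B : Matrix ι ι (MvPolynomial (Fin m) ℚ)} (hA : A.HasFormulas k)
    (hB : B.HasFormulas k) (he : Fintype.card ι ≤ 2 ^ e) : (A * B).HasFormulas (k + 1 + e) :=
  fun i j => HasFormula.sum _ he fun l _ => (hA i l).mul (hB l j)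

/-- Powers are computed by repeated squaring. -/
theorem pow [DecidableEq ι] {k : ℕ} {A : Matrix ι ι (MvPolynomial (Fin m) ℚ)}
    (hA : A.HasFormulas k) (he : Fintype.card ι ≤ 2 ^ e) {r l : ℕ} (hl : l ≤ 2 ^ r) :
    (A ^ l).HasFormulas (k + r * (1 + e)) := by
  induction r generalizing l with
  | zero =>
    obtain rfl | rfl : l = 0 ∨ l = 1 := by omega
    · intro i j
      rw [pow_zero, Matrix.one_apply]
      split_ifs
      · exact HasFormula.one _
      · exact HasFormula.zero _
    · simpa using hA
  | succ r ih =>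
    obtain ⟨a, b, rfl, ha, hb⟩ : ∃ a b, l = a + b ∧ a ≤ 2 ^ r ∧ b ≤ 2 ^ r :=
      ⟨l / 2, l - l / 2, by omega, by omega, by omega⟩
    rw [pow_add]
    exact ((ih ha).mul (ih hb) he).mono (le_of_eq (by ring))

open Matrix in
/-- With `c i` the coefficient of `X ^ (n - i)`, Newton's identities read `c = b + N c` for the
first unit vector `b` and a strictly lower triangular matrix `N` whose entries are rational
multiples of traces of powers of `A`. Hence `c` is the sum of the `N ^ l b`, `l ≤ n`. -/
theorem charpoly_coeff [DecidableEq ι] {k : ℕ} {A : Matrix ι ι (MvPolynomial (Fin m) ℚ)}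
    (hA : A.HasFormulas k) (he : Fintype.card ι + 1 ≤ 2 ^ e) (i : ℕ) :
    HasFormula (k + 2 * (e * (1 + e)) + 2 * e + 1) (A.charpoly.coeff i) := by
  set n := Fintype.card ι with hn
  rcases lt_or_ge n i with hi | hi
  · rw [Polynomial.coeff_eq_zero_of_natDegree_lt (by rwa [charpoly_natDegree_eq_dim])]
    exact HasFormula.zero _
  let N : Matrix (Fin (n + 1)) (Fin (n + 1)) (MvPolynomial (Fin m) ℚ) := fun i j =>
    if j < i then MvPolynomial.C (-(1 / (i : ℚ))) * (A ^ ((i : ℕ) - j)).trace else 0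
  let c : Fin (n + 1) → MvPolynomial (Fin m) ℚ := fun i => A.charpoly.coeff (n - i)
  let b : Fin (n + 1) → MvPolynomial (Fin m) ℚ := Pi.single 0 1
  have hN : N.HasFormulas (k + e * (1 + e) + e + 1) := by
    intro i j
    simp only [N]
    split_ifs
    · exact (HasFormula.C _ _).mul ((hA.pow (r := e) (by omega) (by omega)).trace (by omega))
    · exact HasFormula.zero _
  have hc : c = b + N *ᵥ c := by
    funext i
    have hsum : (N *ᵥ c) i = ∑ j ∈ Finset.range i,
        MvPolynomial.C (-(1 / (i : ℚ))) * (A ^ ((i : ℕ) - j)).trace * A.charpoly.coeff (n - j) := by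
      have h1 : ∀ j : Fin (n + 1), N i j * c j = if (j : ℕ) < i then
          MvPolynomial.C (-(1 / ((i : ℕ) : ℚ))) * (A ^ ((i : ℕ) - j)).trace *
            A.charpoly.coeff (n - j) else 0 := by
        intro j
        simp only [N, c, Fin.lt_def, ite_mul, zero_mul]
      rw [mulVec, dotProduct, Finset.sum_congr rfl fun j _ => h1 j,
        Fin.sum_univ_eq_sum_range (fun j => if j < (i : ℕ) then
          MvPolynomial.C (-(1 / ((i : ℕ) : ℚ))) * (A ^ ((i : ℕ) - j)).trace *
            A.charpoly.coeff (n - j) else 0) (n + 1), ← Finset.sum_filter]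
      congr 1
      ext j
      simp only [Finset.mem_filter, Finset.mem_range]
      omega
    rw [Pi.add_apply, hsum]
    -- row `0` says that the characteristic polynomial is monic, row `i` is the identity for `i`
    rcases eq_or_ne i 0 with rfl | hi0
    · have := A.charpoly_monic
      rw [Polynomial.Monic, Polynomial.leadingCoeff, charpoly_natDegree_eq_dim] at this
      simp [b, c, hn, this]
    · have hi' : ((i : ℕ) : ℚ) ≠ 0 :=
        Nat.cast_ne_zero.2 (Fin.val_ne_zero_iff.2 hi0)
      have h2 := newton_charpoly_coeff A (i := i) (by omega)
      have h3 : MvPolynomial.C (1 / ((i : ℕ) : ℚ)) * ((i : ℕ) : MvPolynomial (Fin m) ℚ) = 1 := by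
        rw [← map_natCast MvPolynomial.C, ← map_mul, one_div_mul_cancel hi', map_one]
      have h4 : ∑ j ∈ Finset.range i, MvPolynomial.C (-(1 / (i : ℚ))) *
          (A ^ ((i : ℕ) - j)).trace * A.charpoly.coeff (n - j) =
          -MvPolynomial.C (1 / (i : ℚ)) * ∑ j ∈ Finset.range i,
            A.charpoly.coeff (n - j) * (A ^ ((i : ℕ) - j)).trace := by
        rw [Finset.mul_sum]
        refine Finset.sum_congr rfl fun j _ => ?_
        rw [map_neg]
        ring
      rw [h4]
      simp only [b, c, Pi.single_eq_of_ne hi0, zero_add]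
      linear_combination MvPolynomial.C (1 / ((i : ℕ) : ℚ)) * h2 - h3 * A.charpoly.coeff (n - i)
  -- `N` is strictly lower triangular, hence nilpotent
  have hNil : ∀ l (i j : Fin (n + 1)), (i : ℕ) < j + l → (N ^ l) i j = 0 := by
    intro l
    induction l with
    | zero =>
      intro i j h
      rw [pow_zero, one_apply_ne]
      rintro rfl
      omega
    | succ l ih =>
      intro i j h
      rw [pow_succ, mul_apply]
      refine Finset.sum_eq_zero fun x _ => ?_
      by_cases hx : j < x
      · rw [ih i x (by omega), zero_mul]
      · simp only [N]
        rw [if_neg hx, mul_zero]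
  have hiter : ∀ l, c = ∑ l ∈ Finset.range l, N ^ l *ᵥ b + N ^ l *ᵥ c := by
    intro l
    induction l with
    | zero => simp
    | succ l ih =>
      rw [Finset.sum_range_succ, pow_succ, ← mulVec_mulVec, add_assoc, ← mulVec_add, ← hc]
      exact ih
  have h0 : N ^ (n + 1) = 0 := by
    ext1 i j
    exact hNil _ _ _ (by omega)
  have h1 := congrFun (hiter (n + 1)) ⟨n - i, by omega⟩
  rw [h0, zero_mulVec, add_zero, Finset.sum_apply] at h1
  have h2 : c ⟨n - i, by omega⟩ = A.charpoly.coeff i := by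
    simp only [c]
    congr 1
    omega
  rw [← h2, h1]
  refine (HasFormula.sum (k := k + e * (1 + e) + e + 1 + e * (1 + e)) (e := e) _
    (by simpa using he) fun l hl => ?_).mono (by omega)
  simp only [b, mulVec_single_one]
  exact hN.pow (by simpa using he) (by rw [Finset.mem_range] at hl; omega) _ _

end Matrix.HasFormulas

theorem Matrix.HasFormulas.det_one_sub {m : ℕ} {ι : Type*} [Fintype ι] [DecidableEq ι] {k e : ℕ}
    {A : Matrix ι ι (MvPolynomial (Fin m) ℚ)} (hA : A.HasFormulas k)
    (he : Fintype.card ι + 1 ≤ 2 ^ e) :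
    HasFormula (k + 2 * (e * (1 + e)) + 3 * e + 1) (1 - A).det := by
  rw [Matrix.det_one_sub]
  exact (HasFormula.sum _ (by simpa using he) fun i _ => hA.charpoly_coeff he i).mono (by omega)

theorem Matrix.HasFormulas.adjugate_one_sub {m : ℕ} {ι : Type*} [Fintype ι] [DecidableEq ι]
    {k e : ℕ} {A : Matrix ι ι (MvPolynomial (Fin m) ℚ)} (hA : A.HasFormulas k)
    (he : Fintype.card ι + 1 ≤ 2 ^ e) :
    (1 - A).adjugate.HasFormulas (k + 2 * (e * (1 + e)) + 4 * e + 2) := by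
  intro i j
  simp only [Matrix.adjugate_one_sub, Matrix.sum_apply, Matrix.smul_apply, smul_eq_mul]
  refine (HasFormula.sum (k := k + 2 * (e * (1 + e)) + 2 * e + 2 + e) (e := e) _
    (by simpa using he) fun r hr => HasFormula.sum _ ?_ fun l hl => ?_).mono (by omega)
  · rw [Finset.card_range]
    rw [Finset.mem_range] at hr
    omega
  · rw [Finset.mem_range] at hr hl
    exact (hA.charpoly_coeff he r).mul
      ((hA.pow (e := e) (r := e) (by omega) (by omega) i j).mono (by omega))

/-! ### Branching programs for products of matrices -/

namespace ABP

variable {m : ℕ}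

open Classical in
/-- The paths with `k` edges that start at `u`. -/
def pathsFrom (A : ABP m) : ℕ → A.V → Finset (List A.V)
  | 0, u => {[u]}
  | k + 1, u => (Finset.univ.filter (A.Edge u)).biUnion fun v =>
      (A.pathsFrom k v).image (List.cons u)

open Classical in
/-- The sum of the labels of the paths with `k` edges that start at `u`, computed along the
layers. -/
def weight (A : ABP m) : ℕ → A.V → MvPolynomial (Fin m) ℚ
  | 0, _ => 1
  | k + 1, u => ∑ v with A.Edge u v, A.label u v * A.weight k v

theorem mem_pathsFrom (A : ABP m) {k : ℕ} {u : A.V} {p : List A.V} :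
    p ∈ A.pathsFrom k u ↔ ∃ q, p = u :: q ∧ q.length = k ∧ (u :: q).IsChain A.Edge := by
  induction k generalizing u p with
  | zero => simp +contextual [pathsFrom]
  | succ k ih =>
    simp only [pathsFrom, Finset.mem_biUnion, Finset.mem_filter, Finset.mem_univ, true_and,
      Finset.mem_image, ih]
    constructor
    · rintro ⟨v, huv, _, ⟨q, rfl, rfl, hq⟩, rfl⟩
      exact ⟨v :: q, rfl, rfl, List.isChain_cons_cons.2 ⟨huv, hq⟩⟩
    · rintro ⟨_ | ⟨v, q⟩, rfl, hlen, hq⟩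
      · simp at hlen
      · rw [List.isChain_cons_cons] at hq
        exact ⟨v, hq.1, v :: q, ⟨q, rfl, by simpa using hlen, hq.2⟩, rfl⟩

theorem sum_pathsFrom (A : ABP m) (k : ℕ) (u : A.V) :
    ∑ p ∈ A.pathsFrom k u, A.pathLabel p = A.weight k u := by
  classical
  induction k generalizing u with
  | zero => simp [pathsFrom, weight, pathLabel]
  | succ k ih =>
    rw [pathsFrom, weight, Finset.sum_biUnion]
    · refine Finset.sum_congr rfl fun v _ => ?_
      rw [Finset.sum_image fun _ _ _ _ h => (List.cons.inj h).2, ← ih, Finset.mul_sum]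
      refine Finset.sum_congr rfl fun p hp => ?_
      obtain ⟨q, rfl, -, -⟩ := A.mem_pathsFrom.1 hp
      simp [pathLabel]
    · intro v _ w _ hvw
      refine Finset.disjoint_left.2 fun p hpv hpw => hvw ?_
      obtain ⟨_, hp, rfl⟩ := Finset.mem_image.1 hpv
      obtain ⟨_, hp', h⟩ := Finset.mem_image.1 hpw
      obtain ⟨q, rfl, -, -⟩ := A.mem_pathsFrom.1 hp
      obtain ⟨q', rfl, -, -⟩ := A.mem_pathsFrom.1 hp'
      simp only [List.cons.injEq, true_and] at h
      exact h.1.symm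

theorem layer_getLast (A : ABP m) (q : List A.V) (u : A.V) (h : (u :: q).IsChain A.Edge) :
    (A.layer ((u :: q).getLast (by simp))).val = (A.layer u).val + q.length := by
  induction q generalizing u with
  | nil => simp
  | cons v q ih =>
    rw [List.isChain_cons_cons] at h
    rw [List.getLast_cons (by simp), ih v h.2, A.edge_layer u v h.1, List.length_cons]
    omega

/-- The maximal paths are the paths with `L` edges that start at the source. -/
theorem isMaximalPath_iff (A : ABP m) {s : A.V} (hs : A.layer s = 0) {p : List A.V} :
    A.IsMaximalPath p ↔ p ∈ A.pathsFrom A.L s := by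
  rw [mem_pathsFrom]
  constructor
  · rintro ⟨⟨hne, hp⟩, hcons, happ⟩
    obtain ⟨u, q, rfl⟩ := List.exists_cons_of_ne_nil hne
    have hu : A.layer u = 0 := by
      by_contra hu
      obtain ⟨v, hv⟩ := A.exists_in u hu
      exact hcons v ⟨by simp, List.isChain_cons_cons.2 ⟨hv, hp⟩⟩
    obtain rfl : u = s := A.source.unique hu hs
    refine ⟨q, rfl, ?_, hp⟩
    have hlast : A.layer ((u :: q).getLast hne) = Fin.last A.L := by
      by_contra hw
      obtain ⟨v, hv⟩ := A.exists_out _ hw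
      refine happ v ⟨by simp, List.isChain_append.2 ⟨hp, List.isChain_singleton _, ?_⟩⟩
      intro x hx y hy
      rw [List.getLast?_eq_getLast_of_ne_nil hne, Option.mem_some_iff] at hx
      rw [List.head?_singleton, Option.mem_some_iff] at hy
      rwa [← hx, ← hy]
    have h := A.layer_getLast q u hp
    rw [hlast, hu] at h
    simpa using h.symm
  · rintro ⟨q, rfl, hlen, hq⟩
    refine ⟨⟨by simp, hq⟩, fun u hu => ?_, fun u hu => ?_⟩
    · have h := A.edge_layer u s (List.isChain_cons_cons.1 hu.2).1
      rw [hs] at h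
      simp at h
    · have h := A.layer_add_length_le (q ++ [u]) s hu.2
      rw [List.length_append, hlen, List.length_singleton] at h
      omega

theorem computes_eq_weight (A : ABP m) {s : A.V} (hs : A.layer s = 0) :
    A.computes = A.weight A.L s := by
  rw [computes, ← sum_pathsFrom]
  congr 1
  ext p
  rw [Set.Finite.mem_toFinset, ← A.isMaximalPath_iff hs]
  rfl

/-- The recursion for `weight` at a vertex whose out-neighbours are enumerated by `f`. -/
theorem weight_succ_eq_sum (A : ABP m) {ι : Type*} [Fintype ι] {k : ℕ} {u : A.V} (f : ι → A.V)
    (hf : Function.Injective f) (hu : ∀ v, A.Edge u v ↔ v ∈ Set.range f) :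
    A.weight (k + 1) u = ∑ i, A.label u (f i) * A.weight k (f i) := by
  classical
  have h : ({v | A.Edge u v} : Finset A.V) = Finset.univ.map ⟨f, hf⟩ := by
    ext v
    simp [hu]
  rw [weight]
  convert Finset.sum_map Finset.univ ⟨f, hf⟩ fun v => A.label u v * A.weight k v <;> rfl

/-- The labels of the branching program for the entry `(a, b)` of the product of the list `l`: the
factors of the product between the inner layers, the unit row vector `a` after the source, and the
unit column vector `b` before the sink. -/
def matrixProductLabel (l : List (Matrix (Fin 4) (Fin 4) (MvPolynomial (Fin m) ℚ)))
    (a b : Fin 4) :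
    Unit ⊕ (Fin (l.length + 1) × Fin 4) ⊕ Unit → Unit ⊕ (Fin (l.length + 1) × Fin 4) ⊕ Unit →
      MvPolynomial (Fin m) ℚ
  | .inl _, .inr (.inl (_, j)) => (1 : Matrix (Fin 4) (Fin 4) _) a j
  | .inr (.inl (k, i)), .inr (.inl (_, j)) => l.getD k 0 i j
  | .inr (.inl (_, i)), .inr (.inr _) => (1 : Matrix (Fin 4) (Fin 4) _) i b
  | _, _ => 0

/-- The layers of the branching program for a product of `N` matrices: the source, `N + 1` copies of
`Fin 4`, and the sink. -/
def matrixProductLayer (N : ℕ) : Unit ⊕ (Fin (N + 1) × Fin 4) ⊕ Unit → Fin (N + 2 + 1)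
  | .inl _ => 0
  | .inr (.inl (k, _)) => ⟨k + 1, by omega⟩
  | .inr (.inr _) => Fin.last _

/-- The branching program that computes the entry `(a, b)` of the product of a list of `4 × 4`
matrices. Consecutive layers are completely connected, with label `0` where nothing should
flow. -/
abbrev ofMatrixProduct (l : List (Matrix (Fin 4) (Fin 4) (MvPolynomial (Fin m) ℚ)))
    (hl : ∀ Q ∈ l, ∀ i j, (Q i j).totalDegree ≤ 1) (a b : Fin 4) : ABP m where
  V := Unit ⊕ (Fin (l.length + 1) × Fin 4) ⊕ Unit
  L := l.length + 2
  layer := matrixProductLayer l.length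
  Edge u v := (matrixProductLayer _ v).val = (matrixProductLayer _ u).val + 1
  label := matrixProductLabel l a b
  edge_layer _ _ h := h
  label_degree := by
    have h1 : ∀ i j : Fin 4,
        ((1 : Matrix (Fin 4) (Fin 4) (MvPolynomial (Fin m) ℚ)) i j).totalDegree ≤ 1 := by
      intro i j
      rw [Matrix.one_apply]
      split_ifs <;> simp
    have h2 : ∀ k i j, (l.getD k 0 i j).totalDegree ≤ 1 := by
      intro k i j
      rcases lt_or_ge k l.length with hk | hk
      · rw [List.getD_eq_getElem _ _ hk]
        exact hl _ (List.getElem_mem hk) i j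
      · rw [List.getD_eq_default _ _ hk]
        simp
    rintro (_ | ⟨k, i⟩ | _) (_ | ⟨k', j⟩ | _) - <;>
      simp only [matrixProductLabel, h1, h2, MvPolynomial.totalDegree_zero, zero_le]
  source := by
    refine ⟨.inl (), rfl, ?_⟩
    rintro (_ | ⟨k, i⟩ | _) h
    · rfl
    · have h := congrArg Fin.val h
      simp [matrixProductLayer] at h
    · have h := congrArg Fin.val h
      simp [matrixProductLayer] at h
  sink := by
    refine ⟨.inr (.inr ()), rfl, ?_⟩
    rintro (_ | ⟨k, i⟩ | _) h
    · simp [matrixProductLayer, Fin.ext_iff] at h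
    · have h := congrArg Fin.val h
      simp only [matrixProductLayer, Fin.val_last] at h
      omega
    · rfl
  exists_in := by
    rintro (_ | ⟨⟨_ | k, hk⟩, i⟩ | _) h
    · exact absurd rfl h
    · exact ⟨.inl (), rfl⟩
    · exact ⟨.inr (.inl (⟨k, by omega⟩, i)), rfl⟩
    · exact ⟨.inr (.inl (Fin.last _, 0)), rfl⟩
  exists_out := by
    rintro (_ | ⟨k, i⟩ | _) h
    · exact ⟨.inr (.inl (0, 0)), rfl⟩
    · rcases lt_or_ge k.val l.length with hk | hk
      · exact ⟨.inr (.inl (⟨k + 1, by omega⟩, i)), rfl⟩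
      · refine ⟨.inr (.inr ()), ?_⟩
        simp only [matrixProductLayer, Fin.val_last]
        omega
    · exact absurd rfl h

section ofMatrixProduct

variable {l : List (Matrix (Fin 4) (Fin 4) (MvPolynomial (Fin m) ℚ))}
  {hl : ∀ Q ∈ l, ∀ i j, (Q i j).totalDegree ≤ 1} {a b : Fin 4}

theorem size_ofMatrixProduct : (ofMatrixProduct l hl a b).size = 4 * l.length + 6 := by
  have : (ofMatrixProduct l hl a b).size =
      Fintype.card (Unit ⊕ (Fin (l.length + 1) × Fin 4) ⊕ Unit) := Fintype.card_congr (Equiv.refl _)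
  rw [this]
  simp only [Fintype.card_sum, Fintype.card_prod, Fintype.card_unit, Fintype.card_fin]
  omega

theorem width_ofMatrixProduct : (ofMatrixProduct l hl a b).width = 4 := by
  refine le_antisymm (Finset.sup_le fun k _ => ?_) ?_
  · let f : {v : (ofMatrixProduct l hl a b).V // (ofMatrixProduct l hl a b).layer v = k} → Fin 4 :=
      fun v => match v with
        | ⟨.inr (.inl (_, i)), _⟩ => i
        | _ => 0
    refine (Nat.card_le_card_of_injective f ?_).trans (by simp)
    rintro ⟨u, rfl⟩ ⟨v, h⟩ hf
    rw [Subtype.mk.injEq]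
    have h : (matrixProductLayer _ v).val = (matrixProductLayer _ u).val := congrArg Fin.val h
    obtain _ | ⟨k₁, i⟩ | _ := u <;> obtain _ | ⟨k₂, j⟩ | _ := v <;>
      simp only [matrixProductLayer, Fin.val_last, Fin.val_zero] at h
    any_goals omega
    · rfl
    · obtain rfl : i = j := hf
      obtain rfl : k₁ = k₂ := Fin.ext (by omega)
      rfl
    · rfl
  -- the bound is attained at the first inner layer
  · let f : Fin 4 → {v : (ofMatrixProduct l hl a b).V // (ofMatrixProduct l hl a b).layer v =
        (⟨1, by simp⟩ : Fin ((ofMatrixProduct l hl a b).L + 1))} :=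
      fun i => ⟨.inr (.inl (0, i)), rfl⟩
    have hf : Function.Injective f := by
      intro i j h
      have h := congrArg Subtype.val h
      exact (Prod.mk.inj (Sum.inl.inj (Sum.inr.inj h))).2
    refine le_trans (le_trans (by simp) (Nat.card_le_card_of_injective f hf))
      (Finset.le_sup (f := fun k => Nat.card {v : (ofMatrixProduct l hl a b).V //
        (ofMatrixProduct l hl a b).layer v = k}) (Finset.mem_univ
          (⟨1, by simp⟩ : Fin ((ofMatrixProduct l hl a b).L + 1))))

/-- From the vertex `i` of the inner layer `k`, the remaining layers compute the entry `(i, b)`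
of the product of the factors from the `k`-th on. -/
theorem weight_ofMatrixProduct {r : ℕ} (k : Fin (l.length + 1)) (hk : k + r = l.length)
    (i : Fin 4) :
    (ofMatrixProduct l hl a b).weight (r + 1)
      (.inr (.inl (k, i)) : Unit ⊕ (Fin (l.length + 1) × Fin 4) ⊕ Unit) =
      (l.drop k).prod i b := by
  induction r generalizing i k with
  | zero =>
    rw [weight_succ_eq_sum _ (fun _ : Unit => (.inr (.inr ()) :
      Unit ⊕ (Fin (l.length + 1) × Fin 4) ⊕ Unit)) (fun _ _ _ => rfl), Fintype.sum_unique, weight]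
    · rw [List.drop_eq_nil_of_le (by omega), List.prod_nil, mul_one]
      rfl
    · intro v
      change (matrixProductLayer _ v).val = k + 1 + 1 ↔ _
      obtain _ | ⟨k', j⟩ | _ := v
      · simp [matrixProductLayer]
      · refine ⟨fun h => ?_, by rintro ⟨_, ⟨⟩⟩⟩
        simp only [matrixProductLayer] at h
        omega
      · simp only [matrixProductLayer, Fin.val_last, Set.mem_range, exists_const, iff_true]
        omega
  | succ r ih =>
    have hk' : (k : ℕ) + 1 < l.length + 1 := by omega
    rw [weight_succ_eq_sum _ (fun j : Fin 4 => (.inr (.inl (⟨k + 1, hk'⟩, j)) :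
      Unit ⊕ (Fin (l.length + 1) × Fin 4) ⊕ Unit))
      (fun _ _ h => (Prod.mk.inj (Sum.inl.inj (Sum.inr.inj h))).2)]
    · rw [List.drop_eq_getElem_cons (by omega), List.prod_cons, Matrix.mul_apply]
      refine Finset.sum_congr rfl fun j _ => ?_
      rw [ih ⟨k + 1, hk'⟩ (by simp only; omega)]
      congr 1
      change l.getD k 0 i j = _
      rw [List.getD_eq_getElem]
    · intro v
      change (matrixProductLayer _ v).val = k + 1 + 1 ↔ _
      obtain _ | ⟨k', j⟩ | _ := v
      · simp [matrixProductLayer]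
      · refine ⟨fun h => ⟨j, ?_⟩, by rintro ⟨_, ⟨⟩⟩; rfl⟩
        simp only [matrixProductLayer] at h
        rw [show k' = ⟨k + 1, hk'⟩ from Fin.ext (by simp only; omega)]
      · refine ⟨fun h => ?_, by rintro ⟨_, ⟨⟩⟩⟩
        simp only [matrixProductLayer, Fin.val_last] at h
        omega

theorem computes_ofMatrixProduct : (ofMatrixProduct l hl a b).computes = l.prod a b := by
  rw [computes_eq_weight _ (s := (.inl () : Unit ⊕ (Fin (l.length + 1) × Fin 4) ⊕ Unit)) rfl]
  change weight _ (l.length + 1 + 1) _ = _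
  rw [weight_succ_eq_sum _ (fun j : Fin 4 => (.inr (.inl (0, j)) :
      Unit ⊕ (Fin (l.length + 1) × Fin 4) ⊕ Unit))
      (fun _ _ h => (Prod.mk.inj (Sum.inl.inj (Sum.inr.inj h))).2)]
  · have h := fun j => weight_ofMatrixProduct (hl := hl) (a := a) (b := b) 0 (zero_add _) j
    simp only [Fin.val_zero, List.drop_zero] at h
    rw [← one_mul l.prod, Matrix.mul_apply]
    refine Finset.sum_congr rfl fun j _ => congrArg₂ _ rfl ?_
    exact h j
  · intro v
    change (matrixProductLayer _ v).val = 0 + 1 ↔ _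
    obtain _ | ⟨k, j⟩ | _ := v
    · simp [matrixProductLayer]
    · refine ⟨fun h => ⟨j, ?_⟩, by rintro ⟨_, ⟨⟩⟩; rfl⟩
      simp only [matrixProductLayer] at h
      rw [show k = 0 from Fin.ext (by simp only [Fin.val_zero]; omega)]
    · simp [matrixProductLayer]

end ofMatrixProduct

end ABP

/-! ### Formulas as products of transvections -/

theorem Matrix.transvection_commutator {ι R : Type*} [Fintype ι] [DecidableEq ι]
    [CommRing R] {i j k : ι} (hki : k ≠ i) (hkj : k ≠ j) (hij : i ≠ j) (f g : R) :
    Matrix.transvection i k f * Matrix.transvection k j g * Matrix.transvection i k (-f) *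
      Matrix.transvection k j (-g) = Matrix.transvection i j (f * g) := by
  have hff : Matrix.single i k f * Matrix.single i k f = 0 :=
    Matrix.single_mul_single_of_ne _ _ _ _ hki _
  have hgg : Matrix.single k j g * Matrix.single k j g = 0 :=
    Matrix.single_mul_single_of_ne _ _ _ _ hkj.symm _
  have hgf : Matrix.single k j g * Matrix.single i k f = 0 :=
    Matrix.single_mul_single_of_ne _ _ _ _ hij.symm _
  have hfg : Matrix.single i k f * Matrix.single k j g = Matrix.single i j (f * g) :=
    Matrix.single_mul_single_same _ _ _ _ _
  rw [Matrix.transvection, Matrix.transvection, Matrix.transvection, Matrix.transvection,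
    Matrix.transvection, ← hfg, ← Matrix.single_neg, ← Matrix.single_neg]
  generalize Matrix.single i k f = a at *
  generalize Matrix.single k j g = b at *
  simp only [mul_add, add_mul, mul_neg, neg_mul, mul_assoc, hff, hgg, hgf, mul_one, one_mul,
    mul_zero, zero_mul]
  abel

theorem HasFormula.exists_list_prod_eq_transvection_of_totalDegree_le {m : ℕ}
    {f : MvPolynomial (Fin m) ℚ} (hf : f.totalDegree ≤ 1) {k : ℕ} {i j : Fin 4} (hij : i ≠ j) :
    ∃ l : List (Matrix (Fin 4) (Fin 4) (MvPolynomial (Fin m) ℚ)), l.length ≤ 4 ^ k ∧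
      (∀ Q ∈ l, ∀ i j, (Q i j).totalDegree ≤ 1) ∧ l.prod = Matrix.transvection i j f := by
  refine ⟨[Matrix.transvection i j f], Nat.one_le_pow _ _ (by norm_num), ?_, by simp⟩
  simp only [List.mem_singleton, forall_eq]
  intro i' j'
  rw [Matrix.transvection, Matrix.add_apply, Matrix.single_apply, Matrix.one_apply]
  split_ifs with h1 h2
  · exact absurd (h2.1.trans (h1.trans h2.2.symm)) hij
  · simp
  · simpa using hf
  · simp

/-- The theorem of Ben-Or and Cleve, for `4 × 4` matrices: in the commutator for a product, a third
index `k` serves as scratch space, and `-f` has a formula of the same depth as `f`. -/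
theorem HasFormula.exists_list_prod_eq_transvection {m k : ℕ}
    {f : MvPolynomial (Fin m) ℚ} (hf : HasFormula k f) {i j : Fin 4} (hij : i ≠ j) :
    ∃ l : List (Matrix (Fin 4) (Fin 4) (MvPolynomial (Fin m) ℚ)), l.length ≤ 4 ^ k ∧
      (∀ Q ∈ l, ∀ i j, (Q i j).totalDegree ≤ 1) ∧ l.prod = Matrix.transvection i j f := by
  induction k generalizing f i j with
  | zero =>
    cases hf with
    | leaf _ hf => exact exists_list_prod_eq_transvection_of_totalDegree_le hf hij
  | succ k ih =>
    cases hf with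
    | leaf _ hf => exact exists_list_prod_eq_transvection_of_totalDegree_le hf hij
    | @add _ f g hf hg =>
      obtain ⟨l₁, hl₁, hd₁, h₁⟩ := ih hf hij
      obtain ⟨l₂, hl₂, hd₂, h₂⟩ := ih hg hij
      refine ⟨l₁ ++ l₂, ?_, ?_, ?_⟩
      · rw [List.length_append, pow_succ]
        omega
      · simp only [List.mem_append]
        rintro Q (hQ | hQ)
        exacts [hd₁ Q hQ, hd₂ Q hQ]
      · rw [List.prod_append, h₁, h₂, Matrix.transvection_mul_transvection_same _ _ hij]
    | @mul _ f g hf hg =>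
      obtain ⟨k, hki, hkj⟩ : ∃ k, k ≠ i ∧ k ≠ j := by
        revert i j
        decide
      obtain ⟨l₁, hl₁, hd₁, h₁⟩ := ih hf hki.symm
      obtain ⟨l₂, hl₂, hd₂, h₂⟩ := ih hg hkj
      obtain ⟨l₃, hl₃, hd₃, h₃⟩ := ih hf.neg hki.symm
      obtain ⟨l₄, hl₄, hd₄, h₄⟩ := ih hg.neg hkj
      refine ⟨l₁ ++ l₂ ++ l₃ ++ l₄, ?_, ?_, ?_⟩
      · simp only [List.length_append]
        rw [pow_succ]
        omega
      · simp only [List.mem_append]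
        rintro Q (((hQ | hQ) | hQ) | hQ)
        exacts [hd₁ Q hQ, hd₂ Q hQ, hd₃ Q hQ, hd₄ Q hQ]
      · simp only [List.prod_append, h₁, h₂, h₃, h₄]
        exact Matrix.transvection_commutator hki hkj hij f g

theorem HasFormula.exists_abp {m k : ℕ} {f : MvPolynomial (Fin m) ℚ}
    (hf : HasFormula k f) :
    ∃ A : ABP m, A.width = 4 ∧ A.size ≤ 4 * 4 ^ k + 6 ∧ A.computes = f := by
  obtain ⟨l, hlen, hl, hprod⟩ :=
    hf.exists_list_prod_eq_transvection (i := 0) (j := 1) (by decide)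
  refine ⟨ABP.ofMatrixProduct l hl 0 1, ABP.width_ofMatrixProduct, ?_, ?_⟩
  · rw [ABP.size_ofMatrixProduct]
    omega
  · rw [ABP.computes_ofMatrixProduct, hprod]
    simp [Matrix.transvection]

/-! ### Parametric Markov chains -/

theorem card_support_le_polySize {m : ℕ} (f : MvPolynomial (Fin m) ℚ) :
    (f.support.card : ℝ) ≤ polySize f := by
  rw [polySize, mul_assoc]
  exact le_mul_of_one_le_right (Nat.cast_nonneg _)
    (one_le_mul_of_one_le_of_one_le (le_max_left _ _) (le_max_left _ _))

theorem totalDegree_le_polySize {m : ℕ} (f : MvPolynomial (Fin m) ℚ) :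
    (f.totalDegree : ℝ) ≤ polySize f := by
  rcases eq_or_ne f 0 with rfl | hf
  · simp [polySize]
  · have h1 : (1 : ℝ) ≤ f.support.card := by
      rw [Nat.one_le_cast, Nat.one_le_iff_ne_zero, Finset.card_ne_zero]
      exact support_nonempty.2 hf
    rw [polySize]
    refine (le_max_right 1 _).trans ?_
    refine (le_mul_of_one_le_left (by positivity) h1).trans ?_
    exact le_mul_of_one_le_right (by positivity) (le_max_left _ _)

theorem polySize_nonneg {m : ℕ} (f : MvPolynomial (Fin m) ℚ) : 0 ≤ polySize f :=
  (Nat.cast_nonneg _).trans (card_support_le_polySize f)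

namespace ParametricMC

variable {n m : ℕ} {M : ParametricMC n m}

theorem polySize_le_size (M : ParametricMC n m) (i j : Fin n) : polySize (M.P i j) ≤ M.size := by
  rw [size]
  refine le_trans ?_ (Finset.single_le_sum (f := fun i => ∑ j, polySize (M.P i j))
    (fun i _ => Finset.sum_nonneg fun j _ => polySize_nonneg _) (Finset.mem_univ i))
  exact Finset.single_le_sum (f := fun j => polySize (M.P i j))
    (fun j _ => polySize_nonneg _) (Finset.mem_univ j)

/-- Every row sums to one at a graph-preserving valuation, so it has a nonzero entry. -/
theorem GraphPreserving.le_size {v : Fin m → ℝ} (hv : M.GraphPreserving v) : (n : ℝ) ≤ M.size := by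
  have h : ∀ i, 1 ≤ ∑ j, polySize (M.P i j) := by
    intro i
    obtain ⟨j, -, hj⟩ := Finset.exists_ne_zero_of_sum_ne_zero
      (show ∑ k, aeval v (M.P i k) ≠ 0 by rw [hv.2 i]; exact one_ne_zero)
    have hP : M.P i j ≠ 0 := by
      rintro h
      exact hj (by rw [h, map_zero])
    have h1 : (1 : ℝ) ≤ (M.P i j).support.card := by
      rw [Nat.one_le_cast, Nat.one_le_iff_ne_zero, Finset.card_ne_zero]
      exact support_nonempty.2 hP
    exact (h1.trans (card_support_le_polySize _)).trans
      (Finset.single_le_sum (f := fun j => polySize (M.P i j))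
        (fun j _ => polySize_nonneg _) (Finset.mem_univ j))
  calc (n : ℝ) = ∑ _i : Fin n, (1 : ℝ) := by simp
    _ ≤ M.size := Finset.sum_le_sum fun i _ => h i

/-- The maximum principle: the states where a vector in the kernel has maximal absolute value form a
set that is closed under transitions, so that it contains the target, where the vector vanishes. -/
theorem det_one_sub_reachMatrix_ne_zero (hM : M.Normalized) {v : Fin m → ℝ}
    (hv : M.GraphPreserving v) : (1 - M.reachMatrix).det ≠ 0 := by
  intro hdet
  have hn := hM.1
  have hmap := congrArg (aeval v : MvPolynomial (Fin m) ℚ →ₐ[ℚ] ℝ) hdet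
  rw [AlgHom.map_det, map_zero] at hmap
  obtain ⟨x, hx0, hx⟩ := Matrix.exists_mulVec_eq_zero_iff.2 hmap
  have hrow : ∀ i, x i = ∑ j, aeval v (M.reachMatrix i j) * x j := by
    intro i
    have h := congrFun hx i
    rw [map_sub, map_one, Matrix.sub_mulVec, Matrix.one_mulVec, Pi.sub_apply, Pi.zero_apply,
      sub_eq_zero] at h
    exact h
  -- the rows of the last two states of `A` are zero
  have hrow0 : ∀ i : Fin n, ¬ i.val + 2 < n → x i = 0 := by
    intro i hi
    rw [hrow i]
    exact Finset.sum_eq_zero fun j _ => by simp [reachMatrix, hi]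
  have hrow1 : ∀ i : Fin n, i.val + 2 < n → x i = ∑ j, aeval v (M.P i j) * x j := by
    intro i hi
    rw [hrow i]
    exact Finset.sum_congr rfl fun j _ => by simp [reachMatrix, hi]
  have hnonneg : ∀ i j, 0 ≤ aeval v (M.P i j) := by
    intro i j
    by_cases h : M.P i j = 0
    · rw [h, map_zero]
    · exact (hv.1 i j h).1.le
  have : Nonempty (Fin n) := ⟨⟨0, by omega⟩⟩
  obtain ⟨i₀, hi₀⟩ := Finite.exists_max fun i => |x i|
  have hpos : 0 < |x i₀| := by
    obtain ⟨i, hi⟩ := Function.ne_iff.1 hx0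
    exact (abs_pos.2 hi).trans_le (hi₀ i)
  have hprop : ∀ s, M.Reaches i₀ s → |x s| = |x i₀| := by
    intro s hs
    induction hs with
    | refl => rfl
    | @tail s u _ hsu ih =>
      have hs2 : s.val + 2 < n := by
        by_contra h
        rw [hrow0 s h, abs_zero] at ih
        exact hpos.ne ih
      refine le_antisymm (hi₀ u) (not_lt.1 fun hlt => ?_)
      have h1 : |x s| < |x i₀| := by
        calc |x s| ≤ ∑ j, |aeval v (M.P s j) * x j| := by
              rw [hrow1 s hs2]
              exact Finset.abs_sum_le_sum_abs _ _
          _ = ∑ j, aeval v (M.P s j) * |x j| :=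
              Finset.sum_congr rfl fun j _ => by rw [abs_mul, abs_of_nonneg (hnonneg s j)]
          _ < ∑ j, aeval v (M.P s j) * |x i₀| :=
              Finset.sum_lt_sum
                (fun j _ => mul_le_mul_of_nonneg_left (hi₀ j) (hnonneg s j))
                ⟨u, Finset.mem_univ u, mul_lt_mul_of_pos_left hlt (hv.1 s u hsu).1⟩
          _ = |x i₀| := by rw [← Finset.sum_mul, hv.2 s, one_mul]
      exact h1.ne ih
  have hi₀2 : i₀.val + 2 < n := by
    by_contra h
    rw [hrow0 i₀ h, abs_zero] at hpos
    exact hpos.false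
  let t : Fin n := ⟨n - 1, by omega⟩
  have hreach : M.Reaches i₀ t := by
    by_contra h
    have := (hM.2 t (by simp only [t]; omega) i₀).1 h
    omega
  have ht := hprop t hreach
  rw [hrow0 t (by simp only [t]; omega), abs_zero] at ht
  exact hpos.ne ht

/-- Cramer's rule. -/
theorem IsValueFunctions.eq_div {g : Fin n → RationalFunction m} (hg : M.IsValueFunctions g)
    (hdet : (1 - M.reachMatrix).det ≠ 0) {t : Fin n} (ht : t.val + 1 = n) (i : Fin n) :
    g i = algebraMap _ (RationalFunction m) ((1 - M.reachMatrix).adjugate i t) /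
      algebraMap _ (RationalFunction m) (1 - M.reachMatrix).det := by
  have hdet' : algebraMap _ (RationalFunction m) (1 - M.reachMatrix).det ≠ 0 := by
    simpa using hdet
  have he : (fun i : Fin n => if i.val + 1 = n then (1 : RationalFunction m) else 0) =
      Pi.single t 1 := by
    funext i
    rw [Pi.single_apply]
    congr 1
    rw [Fin.ext_iff, eq_iff_iff]
    omega
  rw [IsValueFunctions, he] at hg
  have h := congrArg (Matrix.mulVec
    (((1 - M.reachMatrix).adjugate).map (algebraMap _ (RationalFunction m)))) hg
  rw [Matrix.mulVec_mulVec, ← Matrix.map_mul, Matrix.adjugate_mul, Matrix.mulVec_single_one] at h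
  have h2 := congrFun h i
  rw [eq_div_iff hdet', mul_comm]
  simpa [Matrix.mulVec, dotProduct, Matrix.one_apply,
    apply_ite (algebraMap (MvPolynomial (Fin m) ℚ) (RationalFunction m))] using h2

theorem hasFormulas_reachMatrix (M : ParametricMC n m) {q : ℕ} (hq : M.size ≤ 2 ^ q) :
    M.reachMatrix.HasFormulas (2 * q + 1) := by
  intro i j
  rw [reachMatrix, Matrix.of_apply]
  split_ifs
  · refine (HasFormula.of_card_le_of_totalDegree_le (d := q) (e := q) _ ?_ ?_).mono (by omega)
    · exact_mod_cast (totalDegree_le_polySize _).trans ((M.polySize_le_size i j).trans hq)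
    · exact_mod_cast (card_support_le_polySize _).trans ((M.polySize_le_size i j).trans hq)
  · exact HasFormula.zero _

end ParametricMC

/-! ### The branching programs for the partial derivatives -/

/-- The arithmetic behind the size bound: with `q ≤ log₂ s + 1` and `e ≤ log₂ n + 2`, the depth
`k` is `O(log₂ s * log₂ (n * d))`, because `1 ≤ log₂ n ≤ log₂ s`. -/
theorem four_pow_le_rpow {n s d : ℝ} {q e k : ℕ} (hn : 2 ≤ n) (hns : n ≤ s) (hd : 1 ≤ d)
    (hq : (q : ℝ) ≤ Real.logb 2 s + 1) (he : (e : ℝ) ≤ Real.logb 2 n + 2)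
    (hk : k = 2 * (2 * q + 1 + 2 * (e * (1 + e)) + 4 * e + 2) + 2) :
    (4 * 4 ^ k + 6 : ℝ) ≤ s ^ (180 * Real.logb 2 (n * d)) := by
  have hs : 0 < s := by linarith
  set μ := Real.logb 2 s
  set ν := Real.logb 2 n
  set lam := Real.logb 2 (n * d)
  have hν : 1 ≤ ν := by
    rw [Real.le_logb_iff_rpow_le (by norm_num) (by linarith), Real.rpow_one]
    exact hn
  have hμ : ν ≤ μ := Real.logb_le_logb_of_le (by norm_num) (by linarith) hns
  have hlam : ν ≤ lam := Real.logb_le_logb_of_le (by norm_num) (by linarith)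
    (le_mul_of_one_le_right (by linarith) hd)
  have h1 : (4 * 4 ^ k + 6 : ℝ) ≤ (2 : ℝ) ^ ((2 * k + 4 : ℕ) : ℝ) := by
    rw [Real.rpow_natCast, pow_add, pow_mul]
    have : (1 : ℝ) ≤ 4 ^ k := one_le_pow₀ (by norm_num)
    norm_num
    linarith
  have h2 : ((2 * k + 4 : ℕ) : ℝ) ≤ μ * (180 * lam) := by
    have hk' : (k : ℝ) = 2 * (2 * q + 1 + 2 * (e * (1 + e)) + 4 * e + 2) + 2 := by
      exact_mod_cast hk
    have hp1 : μ ≤ μ * lam := le_mul_of_one_le_right (by linarith) (by linarith)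
    have hp2 : ν * ν ≤ μ * lam := mul_le_mul hμ hlam (by linarith) (by linarith)
    -- `k = 4 q + 12 e + 4 e ^ 2 + 8` with `q ≤ 2 μ` and `e ≤ 3 ν`, and `μ`, `ν`, `ν ^ 2`, `1` are
    -- at most `μ * lam`, so that `2 * k + 4 ≤ 180 * (μ * lam)`
    have he3 : (e : ℝ) ≤ 3 * ν := by linarith
    have hee : (e : ℝ) * e ≤ (3 * ν) * (3 * ν) :=
      mul_le_mul he3 he3 (Nat.cast_nonneg _) (by linarith)
    push_cast
    rw [hk']
    nlinarith
  calc (4 * 4 ^ k + 6 : ℝ) ≤ (2 : ℝ) ^ ((2 * k + 4 : ℕ) : ℝ) := h1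
    _ ≤ (2 : ℝ) ^ (μ * (180 * lam)) := Real.rpow_le_rpow_of_exponent_le (by norm_num) h2
    _ = s ^ (180 * lam) := by
      rw [Real.rpow_mul (by norm_num), Real.rpow_logb (by norm_num) (by norm_num) hs]

theorem mainTheorem5 :
    ∃ C : ℝ, ∀ (n m : ℕ) (M : ParametricMC n m), M.Normalized → (∃ v, M.GraphPreserving v) →
      ∀ g : Fin n → RationalFunction m, M.IsValueFunctions g →
        ∃ (N : Fin n → Fin m → ABP m) (D : Fin n → ABP m),
          (∀ i, (D i).width = 4 ∧
            ((D i).size : ℝ) ≤ M.size ^ (C * Real.logb 2 (n * max 1 (M.degree : ℝ)))) ∧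
          (∀ i j, (N i j).width = 4 ∧
            ((N i j).size : ℝ) ≤ M.size ^ (C * Real.logb 2 (n * max 1 (M.degree : ℝ)))) ∧
          ∀ i, (D i).computes ≠ 0 ∧ ∀ j,
            algebraMap _ (RationalFunction m) (N i j).computes /
              algebraMap _ (RationalFunction m) (D i).computes =
            RationalFunction.pderiv j (g i) := by
  refine ⟨180, fun n m M hM ⟨v, hv⟩ g hg => ?_⟩
  have hn : 2 ≤ n := hM.1
  have hn' : (2 : ℝ) ≤ n := by exact_mod_cast hn
  have hns := hv.le_size
  have hdet := M.det_one_sub_reachMatrix_ne_zero hM hv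
  let t : Fin n := ⟨n - 1, by omega⟩
  have ht : t.val + 1 = n := by simp only [t]; omega
  -- `2 ^ q` bounds the size of the chain and `2 ^ e` the orders `n` and `n + 1` of the matrices
  set q := ⌈Real.logb 2 M.size⌉₊
  set e := ⌈Real.logb 2 n⌉₊ + 1
  have hq : M.size ≤ 2 ^ q := by
    rw [← Real.rpow_natCast, ← Real.logb_le_iff_le_rpow (by norm_num) (by linarith)]
    exact Nat.le_ceil _
  have he : n + 1 ≤ 2 ^ e := by
    have h1 : (n : ℝ) ≤ 2 ^ ⌈Real.logb 2 n⌉₊ := by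
      rw [← Real.rpow_natCast, ← Real.logb_le_iff_le_rpow (by norm_num) (by linarith)]
      exact Nat.le_ceil _
    have h2 : n ≤ 2 ^ ⌈Real.logb 2 n⌉₊ := by exact_mod_cast h1
    rw [pow_succ]
    omega
  set K := 2 * q + 1 + 2 * (e * (1 + e)) + 4 * e + 2 with hK
  have hA := M.hasFormulas_reachMatrix hq
  set a : Fin n → MvPolynomial (Fin m) ℚ := fun i => (1 - M.reachMatrix).adjugate i t
  set b : MvPolynomial (Fin m) ℚ := (1 - M.reachMatrix).det
  have ha : ∀ i, HasFormula K (a i) := fun i => hA.adjugate_one_sub (e := e) (by simpa using he) i t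
  have hb : HasFormula K b := (hA.det_one_sub (e := e) (by simpa using he)).mono (by omega)
  -- numerator and denominator of the quotient rule
  have hnum : ∀ i j, HasFormula (2 * K + 2)
      (MvPolynomial.pderiv j (a i) * b - a i * MvPolynomial.pderiv j b) := fun i j =>
    (((ha i).pderiv j).mul (hb.mono (by omega))).sub
      (((ha i).mono (by omega)).mul (hb.pderiv j))
  have hden : HasFormula (2 * K + 2) (b ^ 2) := by
    rw [sq]
    exact (hb.mul hb).mono (by omega)
  have hsize : ∀ A : ABP m, A.size ≤ 4 * 4 ^ (2 * K + 2) + 6 →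
      (A.size : ℝ) ≤ M.size ^ (180 * Real.logb 2 (n * max 1 (M.degree : ℝ))) := by
    intro A hA
    refine le_trans (b := (4 * 4 ^ (2 * K + 2) + 6 : ℝ)) (by exact_mod_cast hA) ?_
    have hq' : (q : ℝ) ≤ Real.logb 2 M.size + 1 :=
      (Nat.ceil_lt_add_one (Real.logb_nonneg (by norm_num) (by linarith))).le
    have he' : (e : ℝ) ≤ Real.logb 2 n + 2 := by
      have := (Nat.ceil_lt_add_one
        (Real.logb_nonneg (b := 2) (x := n) (by norm_num) (by linarith))).le
      push_cast [e]
      linarith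
    exact four_pow_le_rpow hn' hns (le_max_left _ _) hq' he' rfl
  choose N hNw hNs hNc using fun i j => (hnum i j).exists_abp
  obtain ⟨D, hDw, hDs, hDc⟩ := hden.exists_abp
  refine ⟨N, fun _ => D, fun _ => ⟨hDw, hsize _ hDs⟩, fun i j => ⟨hNw i j, hsize _ (hNs i j)⟩,
    fun i => ⟨?_, fun j => ?_⟩⟩
  · rw [hDc]
    exact pow_ne_zero 2 hdet
  · rw [hNc, hDc, hg.eq_div hdet ht, RationalFunction.pderiv_div j _ _ hdet]

end
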